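/- All Banach spaces are real. A set algebra on a set $\Omega$ is a family $\mathcal F$ of subsets of $\Omega$ that contains $\varnothing$ and is closed under complements and finite unions. For a Banach space $X$, a map $\nu\colon\mathcal F\to X$ is called $1$-additive if $\|\nu(A\cup B)-\nu(A)-\nu(B)\|\le 1$ for all disjoint $A,B\in\mathcal F$, and a vector measure is a finitely additive map $\mu\colon\mathcal F\to X$. For a cardinal $\kappa$, a Banach space $X$ has the $\kappa$-SVM property if there is a constant $v<\infty$ such that for every set algebra $\mathcal F$ with $|\mathcal F|<\kappa$ and every $1$-additive $\nu\colon\mathcal F\to X$ there is a vector measure $\mu\colon\mathcal F\to X$ with $\|\nu(A)-\mu(A)\|\le v$ for all $A\in\mathcal F$; in that case $v(\kappa,X)$ denotes the infimum of all such constants $v\geq 0$. $X$ has the SVM property if the same holds, with one constant, for set algebras of arbitrary cardinality. If $X$ does not have the SVM property, $\tau(X)$ denotes the least cardinal $\kappa$ such that $X$ does not have the $\kappa$-SVM property. The assertion $\tau(X)>\kappa$ means that either $X$ has the SVM property, or it does not and the inequality holds. The Kalton–Roberts constant $K$ is the infimum of all $c\ge 0$ such that for every set algebra $\mathcal F$ and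 every $1$-additive $\nu\colon\mathcal F\to\mathbb R$ there is a finitely additive $\mu\colon\mathcal F\to\mathbb R$ with $|\nu(A)-\mu(A)|\le c$ for all $A\in\mathcal F$. The density character of a topological space is the least cardinality of a dense subset. $X$ is $\kappa$-injective if for every Banach space $E$ with density character less than $\kappa$ and every closed subspace $F\subset E$, every bounded linear operator $t\colon F\to X$ extends to a bounded linear operator $T\colon E\to X$. For $\lambda\ge 1$, $X$ is $(\lambda,\kappa)$-injective if $T$ can always be chosen with $\|T\|\le\lambda\|t\|$. **Theorem.** Let $X$ be a Banach space and $\kappa$ a cardinal. (1) If $\kappa$ has uncountable cofinality and $X$ is $\kappa$-injective, then $X$ has the $\kappa$-SVM property; in other words, $\tau(X)>\kappa$. (2) If $\kappa$ is uncountable (of arbitrary cofinality), $\lambda\ge 1$ and $X$ is $(\lambda,\kappa)$-injective, then $X$ has the $\kappa$-SVM property, i.e. $\tau(X)>\kappa$, and $$v(\kappa,X)\le 24\,\lambda K .$$ -/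

import Mathlib

open Cardinal MeasureTheory

universe u v

/-- `ν` is `1`-additive on the family `𝓕`: `‖ν (A ∪ B) - ν A - ν B‖ ≤ 1` for disjoint members.
A set function on `𝓕` is represented by a function on all subsets of `Ω`, of which only the
values on members of `𝓕` are ever used. -/
def IsOneAdditiveOn {Ω : Type u} {X : Type v} [NormedAddCommGroup X]
    (𝓕 : Set (Set Ω)) (ν : Set Ω → X) : Prop :=
  ∀ A ∈ 𝓕, ∀ B ∈ 𝓕, Disjoint A B → ‖ν (A ∪ B) - ν A - ν B‖ ≤ 1

/-- `μ` is a vector measure (a finitely additive set function) on the family `𝓕`. -/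
def IsVectorMeasureOn {Ω : Type u} {X : Type v} [AddCommGroup X]
    (𝓕 : Set (Set Ω)) (μ : Set Ω → X) : Prop :=
  ∀ A ∈ 𝓕, ∀ B ∈ 𝓕, Disjoint A B → μ (A ∪ B) = μ A + μ B

/-- Every `1`-additive `X`-valued function on `𝓕` is within distance `c` of a vector measure. -/
def IsStableOn {Ω : Type u} (𝓕 : Set (Set Ω)) (X : Type v) [NormedAddCommGroup X]
    (c : ℝ) : Prop :=
  ∀ ν : Set Ω → X, IsOneAdditiveOn 𝓕 ν →
    ∃ μ : Set Ω → X, IsVectorMeasureOn 𝓕 μ ∧ ∀ A ∈ 𝓕, ‖ν A - μ A‖ ≤ c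

/-- The `SVM` property (stability of vector measures), with one constant for all set algebras. -/
def HasSVM (X : Type u) [NormedAddCommGroup X] : Prop :=
  ∃ c : ℝ, 0 ≤ c ∧ ∀ (Ω : Type u) (𝓕 : Set (Set Ω)), IsSetAlgebra 𝓕 → IsStableOn 𝓕 X c

/-- `c` is an admissible constant for the `κ`-`SVM` property: it works for all set algebras of
cardinality less than `κ`. -/
def IsSVMConstant (κ : Cardinal.{u}) (X : Type u) [NormedAddCommGroup X] (c : ℝ) : Prop :=
  0 ≤ c ∧ ∀ (Ω : Type u) (𝓕 : Set (Set Ω)), IsSetAlgebra 𝓕 → #𝓕 < κ → IsStableOn 𝓕 X c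

/-- The `κ`-`SVM` property. -/
def HasCardSVM (κ : Cardinal.{u}) (X : Type u) [NormedAddCommGroup X] : Prop :=
  ∃ c : ℝ, IsSVMConstant κ X c

/-- `v(κ, X)`: the infimum of the admissible constants (meaningful if `HasCardSVM κ X`). -/
noncomputable def svmInf (κ : Cardinal.{u}) (X : Type u) [NormedAddCommGroup X] : ℝ :=
  sInf {c : ℝ | IsSVMConstant κ X c}

/-- The `SVM` character `τ(X)`: the least `κ` such that `X` fails the `κ`-`SVM` property
(meaningful if `X` fails the `SVM` property). -/
noncomputable def svmCharacter (X : Type u) [NormedAddCommGroup X] : Cardinal.{u} :=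
  sInf {κ : Cardinal.{u} | ¬ HasCardSVM κ X}

/-- The meaning of `τ(X) > κ`: either `X` has the `SVM` property, or it does not and the
inequality holds for its `SVM` character. -/
def SVMCharacterGT (X : Type u) [NormedAddCommGroup X] (κ : Cardinal.{u}) : Prop :=
  HasSVM X ∨ κ < svmCharacter X

/-- The Kalton–Roberts constant: the best constant approximating real-valued `1`-additive
functions on arbitrary set algebras by finitely additive ones. -/
noncomputable def kaltonRobertsConstant : ℝ :=
  sInf {c : ℝ | 0 ≤ c ∧
    ∀ (Ω : Type u) (𝓕 : Set (Set Ω)), IsSetAlgebra 𝓕 → IsStableOn 𝓕 ℝ c}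

/-- The density character of a topological space: the least cardinality of a dense subset. -/
noncomputable def densityCharacter (E : Type u) [TopologicalSpace E] : Cardinal.{u} :=
  sInf {a : Cardinal.{u} | ∃ s : Set E, Dense s ∧ #s = a}

/-- `κ`-injectivity of a real Banach space `X`: operators into `X` extend from closed subspaces
of Banach spaces with density character less than `κ`. -/
def IsCardInjective (κ : Cardinal.{u}) (X : Type u) [NormedAddCommGroup X]
    [NormedSpace ℝ X] : Prop :=
  ∀ (E : Type u) [NormedAddCommGroup E] [NormedSpace ℝ E] [CompleteSpace E],
    densityCharacter E < κ →
    ∀ F : Submodule ℝ E, IsClosed (F : Set E) →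
    ∀ t : F →L[ℝ] X, ∃ T : E →L[ℝ] X, ∀ x : F, T x = t x

/-- `(lam, κ)`-injectivity: `lam ≥ 1`, and the extension may be chosen with
`‖T‖ ≤ lam * ‖t‖`. -/
def IsBoundedCardInjective (lam : ℝ) (κ : Cardinal.{u}) (X : Type u) [NormedAddCommGroup X]
    [NormedSpace ℝ X] : Prop :=
  1 ≤ lam ∧
  ∀ (E : Type u) [NormedAddCommGroup E] [NormedSpace ℝ E] [CompleteSpace E],
    densityCharacter E < κ →
    ∀ F : Submodule ℝ E, IsClosed (F : Set E) →
    ∀ t : F →L[ℝ] X, ∃ T : E →L[ℝ] X, (∀ x : F, T x = t x) ∧ ‖T‖ ≤ lam * ‖t‖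

/-! Suppose the real-valued case holds with constant `k`. In `ℓ₁(J)`, with `J` the members of the
algebra, let `N` be the span of the vectors `e_{A∪B} - e_A - e_B` with `A`, `B` disjoint. Composing
`ν` with a norming functional and subtracting a nearby real measure, which kills `N`, shows that
`e_A ↦ ν A` has norm at most `k` on `N` (`norm_linearCombination_le_of_mem_additivityRelations`). If
`T` extends this operator from the closure of `N` to `ℓ₁(J)`, then `A ↦ ν A - T e_A` is additive and
within `‖T‖` of `ν`. Injectivity supplies `T`, since `ℓ₁(J)` has density character at most `max #J
ℵ₀`. Without a norm bound on `T`, countably many would-be counterexamples go into a single `ℓ₁`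
space; this is where the cofinality enters.

The real-valued case is the Kalton–Roberts theorem. On a finite power set, a concentrator graph lets
`4n` sets be cut up and reassembled into `3n` sets (`le_sum_of_card_cover_le`). Dually, by
Hahn–Banach, the distance `M` to the measures improves to `3M/4 + 27` (`exists_additive_step`), so
it is at most 108. General algebras reduce to finite ones through atoms. -/

/-! ### Concentrator graphs -/

/-- The maps `a × b → c` that send the whole of `S × b` into `T`. -/
def mapsIntoFinset {a b c : Type*} [Fintype a] [DecidableEq a] [Fintype b] [DecidableEq b]
    [Fintype c] (S : Finset a) (T : Finset c) : Finset (a → b → c) :=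
  Fintype.piFinset fun i => if i ∈ S then Fintype.piFinset fun _ => T else Finset.univ

theorem card_mapsIntoFinset {a b c : Type*} [Fintype a] [DecidableEq a] [Fintype b]
    [DecidableEq b] [Fintype c] (S : Finset a) (T : Finset c) :
    (mapsIntoFinset (b := b) S T).card =
      (T.card ^ Fintype.card b) ^ S.card *
        (Fintype.card c ^ Fintype.card b) ^ (Fintype.card a - S.card) := by
  classical
  have h : ∀ i : a, (if i ∈ S then Fintype.piFinset (fun _ : b => T)
      else (Finset.univ : Finset (b → c))).card =
      if i ∈ S then T.card ^ Fintype.card b else Fintype.card c ^ Fintype.card b := by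
    intro i
    split_ifs <;> simp
  rw [mapsIntoFinset, Fintype.card_piFinset, Finset.prod_congr rfl fun i _ => h i,
    Finset.prod_ite, Finset.prod_const, Finset.prod_const]
  congr 2
  · simp
  · rw [← Finset.card_compl]
    congr 1
    ext i
    simp

theorem choose_le_exp_mul_div_pow (n k : ℕ) (hk : 0 < k) :
    (n.choose k : ℝ) ≤ (Real.exp 1 * n / k) ^ k := by
  have hk' : (0 : ℝ) < k := by exact_mod_cast hk
  have h1 : (n.choose k : ℝ) ≤ (n : ℝ) ^ k / k.factorial := Nat.choose_le_pow_div k n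
  have h2 := Real.pow_div_factorial_le_exp (x := k) hk'.le k
  have h3 : (Real.exp 1) ^ k = Real.exp k := by rw [← Real.exp_nat_mul, mul_one]
  have hf : (0 : ℝ) < k.factorial := by exact_mod_cast k.factorial_pos
  rw [div_le_iff₀ hf] at h2
  refine h1.trans ?_
  rw [div_pow, mul_pow, h3, div_le_div_iff₀ hf (by positivity)]
  calc (n : ℝ) ^ k * (k : ℝ) ^ k ≤ (n : ℝ) ^ k * (Real.exp k * k.factorial) := by gcongr
    _ = _ := by ring

/-- The union bound for `exists_concentrator`: a random map traps some `k` inputs in some `k`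
outputs with probability at most `4⁻ᵏ`. Since `k ≤ 2n`, the base is at most `12 · 9 · 2¹⁰ / 3¹² <
1/4`, which is why degree 12 suffices. -/
theorem choose_mul_choose_mul_pow_le (n k : ℕ) (hk : 0 < k) (hkn : k ≤ 2 * n) :
    ((4 * n).choose k : ℝ) * ((3 * n).choose k) * ((k : ℝ) ^ 12) ^ k ≤
      (((3 * n : ℕ) : ℝ) ^ 12) ^ k * (1 / 4) ^ k := by
  have hk' : (0 : ℝ) < k := by exact_mod_cast hk
  have hn : (0 : ℝ) < n := by
    have : 0 < n := by omega
    exact_mod_cast this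
  have hkn' : (k : ℝ) ≤ 2 * n := by exact_mod_cast hkn
  have h4 := choose_le_exp_mul_div_pow (4 * n) k hk
  have h3 := choose_le_exp_mul_div_pow (3 * n) k hk
  calc ((4 * n).choose k : ℝ) * ((3 * n).choose k) * ((k : ℝ) ^ 12) ^ k
      ≤ (Real.exp 1 * (4 * n : ℕ) / k) ^ k * (Real.exp 1 * (3 * n : ℕ) / k) ^ k *
          ((k : ℝ) ^ 12) ^ k := by gcongr
    _ = (12 * (Real.exp 1) ^ 2 * (n : ℝ) ^ 2 * (k : ℝ) ^ 10) ^ k := by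
        rw [← mul_pow, ← mul_pow]
        congr 1
        push_cast
        field_simp
        ring
    _ ≤ (((3 * n : ℕ) : ℝ) ^ 12 * (1 / 4)) ^ k := by
        refine pow_le_pow_left₀ (by positivity) ?_ k
        have he : (Real.exp 1) ^ 2 ≤ 9 := by
          have := Real.exp_one_lt_d9
          have h0 := Real.exp_pos 1
          nlinarith
        have hk10 : (k : ℝ) ^ 10 ≤ (2 * n) ^ 10 := by gcongr
        calc 12 * (Real.exp 1) ^ 2 * (n : ℝ) ^ 2 * (k : ℝ) ^ 10
            ≤ 12 * 9 * (n : ℝ) ^ 2 * (2 * n) ^ 10 := by gcongr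
          _ = (12 * 9 * 2 ^ 10) * (n : ℝ) ^ 12 := by ring
          _ ≤ (3 ^ 12 * (1 / 4)) * (n : ℝ) ^ 12 := by
              refine mul_le_mul_of_nonneg_right ?_ (by positivity)
              norm_num
          _ = _ := by push_cast; ring
    _ = _ := by rw [mul_pow]

theorem sum_one_quarter_pow_lt_one (N : ℕ) :
    ∑ k ∈ Finset.Icc 1 N, (1 / 4 : ℝ) ^ k < 1 := by
  have h : ∑ k ∈ Finset.Icc 1 N, (1 / 4 : ℝ) ^ k = (1 - (1 / 4) ^ N) / 3 := by
    induction N with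
    | zero => simp
    | succ n ih =>
      rw [Finset.sum_Icc_succ_top (by omega), ih]
      ring
  have : (0 : ℝ) < (1 / 4) ^ N := by positivity
  rw [h]
  linarith

/-- There is a bipartite graph with `4n` inputs of degree at most `12` and `3n` outputs such that
Hall's condition holds for all sets of at most `2n` inputs. -/
theorem exists_concentrator (n : ℕ) :
    ∃ R : Fin (4 * n) → Fin 12 → Fin (3 * n), ∀ S : Finset (Fin (4 * n)), S.card ≤ 2 * n →
      S.card ≤ (S.biUnion fun i => Finset.univ.image (R i)).card := by
  classical
  rcases Nat.eq_zero_or_pos n with rfl | hn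
  · refine ⟨fun i => absurd i.2 (by simp), fun S hS => ?_⟩
    omega
  -- Counting: if every map fails Hall's condition, the maps trapping some `k`-set of inputs in a
  -- `k`-set of outputs exhaust all maps, yet they form a proportion of at most `∑ 4⁻ᵏ < 1`.
  by_contra! hR
  have hcover : (Finset.univ : Finset (Fin (4 * n) → Fin 12 → Fin (3 * n))) ⊆
      (Finset.Icc 1 (2 * n)).biUnion fun k =>
        (Finset.powersetCard k (Finset.univ : Finset (Fin (4 * n))) ×ˢ
          Finset.powersetCard k (Finset.univ : Finset (Fin (3 * n)))).biUnion fun p =>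
            mapsIntoFinset p.1 p.2 := by
    intro R _
    obtain ⟨S, hS, hlt⟩ := hR R
    obtain ⟨T, hT, hTc⟩ := Finset.exists_superset_card_eq hlt.le
      (by rw [Fintype.card_fin]; omega)
    simp only [Finset.mem_biUnion, Finset.mem_Icc, Finset.mem_product, Finset.mem_powersetCard,
      Finset.subset_univ, true_and]
    refine ⟨S.card, ⟨by omega, hS⟩, (S, T), ⟨rfl, hTc⟩, ?_⟩
    rw [mapsIntoFinset, Fintype.mem_piFinset]
    intro i
    dsimp only
    split_ifs with hi
    · rw [Fintype.mem_piFinset]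
      exact fun j => hT (Finset.mem_biUnion.2 ⟨i, hi, Finset.mem_image_of_mem _ (Finset.mem_univ j)⟩)
    · exact Finset.mem_univ _
  have hcard := (Finset.card_le_card hcover).trans Finset.card_biUnion_le
  have hk : ∀ k ∈ Finset.Icc 1 (2 * n),
      (((Finset.powersetCard k (Finset.univ : Finset (Fin (4 * n))) ×ˢ
          Finset.powersetCard k (Finset.univ : Finset (Fin (3 * n)))).biUnion fun p =>
            mapsIntoFinset (b := Fin 12) p.1 p.2).card : ℝ) ≤
        (((3 * n : ℕ) : ℝ) ^ 12) ^ (4 * n) * (1 / 4) ^ k := by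
    intro k hk
    rw [Finset.mem_Icc] at hk
    have h1 : ((Finset.powersetCard k (Finset.univ : Finset (Fin (4 * n))) ×ˢ
          Finset.powersetCard k (Finset.univ : Finset (Fin (3 * n)))).biUnion fun p =>
            mapsIntoFinset (b := Fin 12) p.1 p.2).card ≤
        ((4 * n).choose k * (3 * n).choose k) *
          ((k ^ 12) ^ k * ((3 * n) ^ 12) ^ (4 * n - k)) := by
      refine (Finset.card_biUnion_le_card_mul _ _ ((k ^ 12) ^ k * ((3 * n) ^ 12) ^ (4 * n - k))
        fun p hp => ?_).trans_eq ?_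
      · simp only [Finset.mem_product, Finset.mem_powersetCard] at hp
        rw [card_mapsIntoFinset, hp.1.2, hp.2.2]
        simp
      · simp [Finset.card_product]
    have h2 : (((3 * n : ℕ) : ℝ) ^ 12) ^ (4 * n) =
        (((3 * n : ℕ) : ℝ) ^ 12) ^ k * (((3 * n : ℕ) : ℝ) ^ 12) ^ (4 * n - k) := by
      rw [← pow_add]
      congr 1
      omega
    calc _ ≤ (((4 * n).choose k * (3 * n).choose k *
          ((k ^ 12) ^ k * ((3 * n) ^ 12) ^ (4 * n - k)) : ℕ) : ℝ) := by exact_mod_cast h1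
      _ = (((4 * n).choose k : ℝ) * ((3 * n).choose k) * ((k : ℝ) ^ 12) ^ k) *
          (((3 * n : ℕ) : ℝ) ^ 12) ^ (4 * n - k) := by push_cast; ring
      _ ≤ ((((3 * n : ℕ) : ℝ) ^ 12) ^ k * (1 / 4) ^ k) *
          (((3 * n : ℕ) : ℝ) ^ 12) ^ (4 * n - k) := by
          exact mul_le_mul_of_nonneg_right
            (choose_mul_choose_mul_pow_le n k (by omega) hk.2) (by positivity)
      _ = _ := by rw [h2]; ring
  have htotal : (((3 * n : ℕ) : ℝ) ^ 12) ^ (4 * n) ≤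
      (((3 * n : ℕ) : ℝ) ^ 12) ^ (4 * n) * ∑ k ∈ Finset.Icc 1 (2 * n), (1 / 4 : ℝ) ^ k := by
    rw [Finset.mul_sum]
    refine le_trans ?_ (Finset.sum_le_sum hk)
    have : (Finset.univ : Finset (Fin (4 * n) → Fin 12 → Fin (3 * n))).card =
        ((3 * n) ^ 12) ^ (4 * n) := by simp
    rw [this] at hcard
    exact_mod_cast hcard
  have hpos : (0 : ℝ) < (((3 * n : ℕ) : ℝ) ^ 12) ^ (4 * n) := by positivity
  nlinarith [sum_one_quarter_pow_lt_one (2 * n)]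

/-! ### Nearly additive functions on finite power sets -/

/-- `f` is `1`-additive on the power set of a finite type. -/
def IsNearlyAdditive {W : Type*} [DecidableEq W] (f : Finset W → ℝ) : Prop :=
  ∀ A B : Finset W, Disjoint A B → |f (A ∪ B) - f A - f B| ≤ 1

namespace IsNearlyAdditive

variable {W : Type*} [DecidableEq W] {f : Finset W → ℝ}

theorem neg (hf : IsNearlyAdditive f) : IsNearlyAdditive fun A => -f A := by
  intro A B h
  have := hf A B h
  rw [← abs_neg] at this
  convert this using 2
  ring

theorem sub_sum (hf : IsNearlyAdditive f) (μ : W → ℝ) :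
    IsNearlyAdditive fun A => f A - ∑ x ∈ A, μ x := by
  intro A B h
  simp only [Finset.sum_union h]
  convert hf A B h using 2
  ring

theorem abs_empty_le (hf : IsNearlyAdditive f) : |f ∅| ≤ 1 := by
  have := hf ∅ ∅ (Finset.disjoint_empty_left _)
  rw [Finset.union_empty, ← abs_neg] at this
  convert this using 2
  ring

theorem abs_biUnion_sub_sum_le (hf : IsNearlyAdditive f) {ι : Type*} [DecidableEq ι]
    (s : Finset ι) (D : ι → Finset W)
    (hD : ∀ i ∈ s, ∀ j ∈ s, i ≠ j → Disjoint (D i) (D j)) :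
    |f (s.biUnion D) - ∑ i ∈ s, f (D i)| ≤ s.card + 1 := by
  induction s using Finset.induction_on with
  | empty => simpa using hf.abs_empty_le
  | insert a s ha ih =>
    have hdis : Disjoint (D a) (s.biUnion D) := by
      rw [Finset.disjoint_biUnion_right]
      intro i hi
      exact hD a (Finset.mem_insert_self _ _) i (Finset.mem_insert_of_mem hi)
        (fun h => ha (h ▸ hi))
    have h1 := hf _ _ hdis
    have h2 := ih fun i hi j hj => hD i (Finset.mem_insert_of_mem hi) j
      (Finset.mem_insert_of_mem hj)
    rw [Finset.biUnion_insert, Finset.sum_insert ha, Finset.card_insert_of_notMem ha]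
    push_cast
    rw [abs_le] at h1 h2 ⊢
    constructor <;> linarith [h1.1, h1.2, h2.1, h2.2]

/-- Each point `x` lies in at most `2n` of the sets, so Hall's theorem matches those sets
injectively to outputs of the concentrator. Cutting `D i` according to the edge its points use gives
12 pieces; pieces arriving at one output are disjoint, and their union has value at least `-M`. With
`4n` sets and `3n` outputs the errors are at most `13 · 4n + 12 · 4n + 3n = 103n`. -/
theorem le_sum_of_card_cover_le (hf : IsNearlyAdditive f) {M : ℝ}
    (hM : ∀ A, -M ≤ f A) (n : ℕ) {ι : Type*} [Fintype ι] [DecidableEq ι]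
    (hι : Fintype.card ι ≤ 4 * n) (D : ι → Finset W)
    (hD : ∀ x, (Finset.univ.filter fun i => x ∈ D i).card ≤ 2 * n) :
    -(3 * n * M) - 103 * n ≤ ∑ i, f (D i) := by
  classical
  obtain ⟨R₀, hR₀⟩ := exists_concentrator n
  obtain ⟨e⟩ : Nonempty (ι ↪ Fin (4 * n)) :=
    Function.Embedding.nonempty_of_card_le (by simpa using hι)
  let R : ι → Fin 12 → Fin (3 * n) := fun i => R₀ (e i)
  have hR : ∀ S : Finset ι, S.card ≤ 2 * n →
      S.card ≤ (S.biUnion fun i => Finset.univ.image (R i)).card := by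
    intro S hS
    have := hR₀ (S.map e) (by simpa using hS)
    rw [Finset.card_map, Finset.map_eq_image, Finset.image_biUnion] at this
    exact this
  have hmatch : ∀ x, ∃ j : ι → Fin 12, ∀ i i', x ∈ D i → x ∈ D i' →
      R i (j i) = R i' (j i') → i = i' := by
    intro x
    let S := Finset.univ.filter fun i => x ∈ D i
    have hHall := (Finset.all_card_le_biUnion_card_iff_exists_injective
      (fun i : S => Finset.univ.image (R i))).1 (fun s => by
        have h := hR (s.map (Function.Embedding.subtype _)) ((Finset.card_le_card (t := S) (by
          intro i hi
          obtain ⟨y, -, rfl⟩ := Finset.mem_map.1 hi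
          exact y.2)).trans (hD x))
        rw [Finset.card_map, Finset.map_eq_image, Finset.image_biUnion] at h
        exact h)
    obtain ⟨φ, hφ, hφR⟩ := hHall
    have : ∀ i : ι, ∃ j : Fin 12, ∀ hi : i ∈ S, R i j = φ ⟨i, hi⟩ := by
      intro i
      by_cases hi : i ∈ S
      · obtain ⟨j, -, hj⟩ := Finset.mem_image.1 (hφR ⟨i, hi⟩)
        exact ⟨j, fun _ => hj⟩
      · exact ⟨0, fun h => absurd h hi⟩
    choose j hj using this
    refine ⟨j, fun i i' hi hi' h => ?_⟩
    have hiS : i ∈ S := by simpa [S] using hi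
    have hiS' : i' ∈ S := by simpa [S] using hi'
    rw [hj i hiS, hj i' hiS'] at h
    exact congrArg Subtype.val (hφ h)
  choose j hj using hmatch
  let P : ι × Fin 12 → Finset W := fun p => (D p.1).filter fun x => j x p.1 = p.2
  have hDP : ∀ i, Finset.univ.biUnion (fun k => P (i, k)) = D i := by
    intro i
    ext x
    simp [P]
  have hrow : ∀ i, ∑ k, f (P (i, k)) - 13 ≤ f (D i) := by
    intro i
    have h := hf.abs_biUnion_sub_sum_le Finset.univ (fun k => P (i, k)) (by
      intro k _ k' _ hk
      rw [Finset.disjoint_left]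
      intro x hx hx'
      simp only [P, Finset.mem_filter] at hx hx'
      exact hk (hx.2.symm.trans hx'.2))
    rw [hDP, abs_le] at h
    norm_num at h
    linarith [h.1]
  let Y : Fin (3 * n) → Finset (ι × Fin 12) := fun y =>
    Finset.univ.filter fun p => R p.1 p.2 = y
  have hcol : ∀ y, -M - ((Y y).card + 1) ≤ ∑ p ∈ Y y, f (P p) := by
    intro y
    have h := hf.abs_biUnion_sub_sum_le (Y y) P (by
      rintro ⟨i, k⟩ hp ⟨i', k'⟩ hp' hne
      rw [Finset.disjoint_left]
      intro x hx hx'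
      simp only [P, Y, Finset.mem_filter, Finset.mem_univ, true_and] at hx hx' hp hp'
      have hii : i = i' := hj x i i' hx.1 hx'.1 (by rw [hx.2, hx'.2, hp, hp'])
      subst hii
      exact hne (by rw [← hx.2, ← hx'.2]))
    rw [abs_le] at h
    linarith [h.1, h.2, hM ((Y y).biUnion P)]
  have hsum : ∑ p, f (P p) = ∑ y, ∑ p ∈ Y y, f (P p) :=
    (Finset.sum_fiberwise Finset.univ (fun p : ι × Fin 12 => R p.1 p.2) fun p => f (P p)).symm
  have hYcard : ∑ y, ((Y y).card : ℝ) = 12 * Fintype.card ι := by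
    have h := Finset.card_eq_sum_card_fiberwise (s := (Finset.univ : Finset (ι × Fin 12)))
      (t := (Finset.univ : Finset (Fin (3 * n)))) (f := fun p => R p.1 p.2) (by simp)
    have h' : Fintype.card ι * 12 = ∑ y, (Y y).card := by simpa [Y] using h
    rw [mul_comm (12 : ℝ)]
    exact_mod_cast h'.symm
  have h1 : ∑ p, f (P p) - 13 * Fintype.card ι ≤ ∑ i, f (D i) := by
    rw [Fintype.sum_prod_type]
    have := Finset.sum_le_sum fun i (_ : i ∈ (Finset.univ : Finset ι)) => hrow i
    rw [Finset.sum_sub_distrib] at this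
    simp only [Finset.sum_const, Finset.card_univ, nsmul_eq_mul] at this
    linarith
  have h2 : -(3 * n * M) - 12 * Fintype.card ι - 3 * n ≤ ∑ p, f (P p) := by
    rw [hsum]
    have := Finset.sum_le_sum fun y (_ : y ∈ (Finset.univ : Finset (Fin (3 * n)))) => hcol y
    rw [Finset.sum_sub_distrib, Finset.sum_add_distrib, hYcard] at this
    simp only [Finset.sum_const, Finset.card_univ, nsmul_eq_mul, Fintype.card_fin] at this
    push_cast at this
    linarith
  have h3 : (Fintype.card ι : ℝ) ≤ 4 * n := by exact_mod_cast hι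
  linarith

/-- Rescale the weights to total `4n`, round down, and use them as multiplicities in
`le_sum_of_card_cover_le`. -/
theorem le_sum_weighted [Fintype W] (hf : IsNearlyAdditive f) {M : ℝ} (hM : ∀ A, -M ≤ f A)
    (w : Finset W → ℝ) (hw : ∀ A, 0 ≤ w A)
    (hcov : ∀ x, ∑ A with x ∈ A, w A ≤ (∑ A, w A) / 2) :
    -((3 / 4 * M + 26) * ∑ A, w A) ≤ ∑ A, w A * f A := by
  classical
  set s := ∑ A, w A with hs
  have hs0 : 0 ≤ s := Finset.sum_nonneg fun A _ => hw A
  rcases hs0.eq_or_lt with h0 | hpos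
  · have : ∀ A, w A = 0 := fun A =>
      (Finset.sum_eq_zero_iff_of_nonneg fun A _ => hw A).1 (hs.symm.trans h0.symm) A
        (Finset.mem_univ A)
    simp [this, ← h0]
  set B := ∑ A, |f A| with hB
  -- Rounding costs at most `B ≤ n`, so 103 becomes 104, and division by `4n` leaves 26.
  obtain ⟨n, hn⟩ := exists_nat_ge (max 1 B)
  have hn1 : (1 : ℝ) ≤ n := (le_max_left _ _).trans hn
  have hnB : B ≤ n := (le_max_right _ _).trans hn
  let m : Finset W → ℕ := fun A => ⌊4 * n * w A / s⌋₊
  have hm : ∀ A, (m A : ℝ) ≤ 4 * n * w A / s := fun A =>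
    Nat.floor_le (by have := hw A; positivity)
  have hm' : ∀ A, 4 * n * w A / s ≤ m A + 1 := fun A => (Nat.lt_floor_add_one _).le
  have hcard : Fintype.card (Σ A : Finset W, Fin (m A)) ≤ 4 * n := by
    have : (Fintype.card (Σ A : Finset W, Fin (m A)) : ℝ) ≤ 4 * n := by
      rw [Fintype.card_sigma]
      push_cast
      simp only [Fintype.card_fin]
      calc ∑ A, (m A : ℝ) ≤ ∑ A, 4 * n * w A / s := Finset.sum_le_sum fun A _ => hm A
        _ = 4 * n := by
          rw [← Finset.sum_div, ← Finset.mul_sum, ← hs]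
          field_simp
    exact_mod_cast this
  have hcover : ∀ x, (Finset.univ.filter fun p : (Σ A : Finset W, Fin (m A)) =>
      x ∈ p.1).card ≤ 2 * n := by
    intro x
    have h1 : (Finset.univ.filter fun p : (Σ A : Finset W, Fin (m A)) => x ∈ p.1) =
        (Finset.univ.filter fun A => x ∈ A).sigma fun _ => Finset.univ := by
      ext p
      simp
    have : (((Finset.univ.filter fun A => x ∈ A).sigma
        fun A => (Finset.univ : Finset (Fin (m A)))).card : ℝ) ≤ 2 * n := by
      rw [Finset.card_sigma]
      push_cast
      simp only [Finset.card_univ, Fintype.card_fin]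
      calc ∑ A with x ∈ A, (m A : ℝ) ≤ ∑ A with x ∈ A, 4 * n * w A / s :=
            Finset.sum_le_sum fun A _ => hm A
        _ = 4 * n * (∑ A with x ∈ A, w A) / s := by
            rw [← Finset.sum_div, ← Finset.mul_sum]
        _ ≤ 4 * n * (s / 2) / s := by
            gcongr
            exact hcov x
        _ = 2 * n := by
            field_simp
            ring
    rw [h1]
    exact_mod_cast this
  have hmain := hf.le_sum_of_card_cover_le hM n hcard (fun p => p.1) hcover
  rw [Fintype.sum_sigma] at hmain
  simp only [Finset.sum_const, Finset.card_univ, Fintype.card_fin, nsmul_eq_mul] at hmain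
  have hcmp : ∑ A, (m A : ℝ) * f A - B ≤ ∑ A, 4 * n * w A / s * f A := by
    rw [hB, ← Finset.sum_sub_distrib]
    refine Finset.sum_le_sum fun A _ => ?_
    have h1 := hm A
    have h2 := hm' A
    have h3 : |(m A - 4 * n * w A / s) * f A| ≤ 1 * |f A| := by
      rw [abs_mul]
      gcongr
      rw [abs_le]
      constructor <;> linarith
    have h4 := (abs_le.1 h3).2
    linarith
  have hfac : ∑ A, 4 * n * w A / s * f A = 4 * n / s * ∑ A, w A * f A := by
    rw [Finset.mul_sum]
    exact Finset.sum_congr rfl fun A _ => by ring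
  rw [hfac] at hcmp
  have hfin : -(3 * n * M) - 104 * n ≤ 4 * n / s * ∑ A, w A * f A := by linarith
  have h5 : 4 * n / s * (-((3 / 4 * M + 26) * s)) = -(3 * n * M) - 104 * n := by
    field_simp
    ring
  rw [← h5] at hfin
  exact le_of_mul_le_mul_left hfin (by positivity)

end IsNearlyAdditive

/-! ### Operators on `ℓ₁(J)` -/

/-- A linear map on a subspace of `V` that is bounded in the norm of `E` pulled back along
`i : V → E` gives rise to an operator on a closed subspace of `E`. -/
theorem exists_operator_on_closure {V E X : Type*} [AddCommGroup V] [Module ℝ V]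
    [NormedAddCommGroup E] [NormedSpace ℝ E] [NormedAddCommGroup X] [NormedSpace ℝ X]
    [CompleteSpace X] (i : V →ₗ[ℝ] E) (N : Submodule ℝ V) (L : V →ₗ[ℝ] X) {C : ℝ} (hC : 0 ≤ C)
    (hL : ∀ c ∈ N, ‖L c‖ ≤ C * ‖i c‖) :
    ∃ (F : Submodule ℝ E) (t : F →L[ℝ] X), IsClosed (F : Set E) ∧ ‖t‖ ≤ C ∧
      ∀ T : E →L[ℝ] X, (∀ x : F, T x = t x) → ∀ c ∈ N, L c = T (i c) := by
  let F := (N.map i).topologicalClosure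
  have hmem : ∀ c : N, i c ∈ F := fun c =>
    Submodule.le_topologicalClosure _ (Submodule.mem_map_of_mem c.2)
  let e : N →ₗ[ℝ] F := LinearMap.codRestrict F (i.comp N.subtype) hmem
  have hdense : DenseRange e := by
    rintro ⟨x, hx⟩
    rw [closure_subtype]
    refine closure_mono ?_ hx
    rintro _ ⟨c, hc, rfl⟩
    exact ⟨e ⟨c, hc⟩, ⟨⟨c, hc⟩, rfl⟩, rfl⟩
  let f : N →ₗ[ℝ] X := L.comp N.subtype
  have hf : ∀ c, ‖f c‖ ≤ C * ‖e c‖ := fun c => hL c c.2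
  refine ⟨F, f.extendOfNorm e, Submodule.isClosed_topologicalClosure _,
    LinearMap.opNorm_extendOfNorm_le hdense hC hf, fun T hT c hc => ?_⟩
  have h1 := LinearMap.extendOfNorm_eq hdense ⟨C, hf⟩ (⟨c, hc⟩ : N)
  have h2 := hT (e ⟨c, hc⟩)
  rw [h1] at h2
  exact h2.symm

/-- The space `ℓ₁(J)`. -/
abbrev EllOne (J : Type u) : Type u := lp (fun _ : J => ℝ) 1

namespace EllOne

variable {J : Type u}

/-- The unit vector basis of `ℓ₁(J)`. -/
noncomputable def basisVector (j : J) : EllOne J := by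
  classical exact lp.single 1 j (1 : ℝ)

theorem norm_basisVector (j : J) : ‖basisVector j‖ = 1 := by
  classical
  rw [basisVector, lp.norm_single (by simp)]
  simp

open Classical in
theorem smul_basisVector (j : J) (a : ℝ) :
    a • basisVector j = lp.single (E := fun _ : J => ℝ) 1 j a := by
  rw [basisVector, ← lp.single_smul, smul_eq_mul, mul_one]

/-- The embedding of the finitely supported functions into `ℓ₁(J)`. -/
noncomputable def ofFinsupp (J : Type u) : (J →₀ ℝ) →ₗ[ℝ] EllOne J :=
  Finsupp.linearCombination ℝ basisVector

theorem norm_ofFinsupp (c : J →₀ ℝ) : ‖ofFinsupp J c‖ = ∑ j ∈ c.support, |c j| := by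
  classical
  have h := lp.norm_sum_single (E := fun _ : J => ℝ) (p := 1) (by simp) c c.support
  simp only [ENNReal.toReal_one, Real.rpow_one, Real.norm_eq_abs] at h
  rw [← h, ofFinsupp, Finsupp.linearCombination_apply, Finsupp.sum]
  simp only [smul_basisVector]

/-- The finitely supported rational elements of `ℓ₁(J)`. -/
noncomputable def rationalPart (J : Type u) : AddSubgroup (EllOne J) :=
  AddMonoidHom.range <| (ofFinsupp J).toAddMonoidHom.comp
    (Finsupp.mapRange.addMonoidHom (Rat.castHom ℝ : ℚ →+* ℝ).toAddMonoidHom)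

theorem dense_rationalPart : Dense (rationalPart J : Set (EllOne J)) := by
  classical
  have hq : ∀ (j : J) (q : ℚ), (q : ℝ) • basisVector j ∈ rationalPart J := by
    intro j q
    refine ⟨Finsupp.single j q, ?_⟩
    simp [ofFinsupp]
  have hr : ∀ (j : J) (a : ℝ), a • basisVector j ∈ (rationalPart J).topologicalClosure := by
    intro j a
    have hcl : IsClosed {b : ℝ | b • basisVector j ∈ (rationalPart J).topologicalClosure} :=
      (rationalPart J).isClosed_topologicalClosure.preimage (by fun_prop)
    have hsub : Set.range ((↑) : ℚ → ℝ) ⊆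
        {b : ℝ | b • basisVector j ∈ (rationalPart J).topologicalClosure} := by
      rintro _ ⟨q, rfl⟩
      exact (rationalPart J).le_topologicalClosure (hq j q)
    exact hcl.closure_subset_iff.2 hsub (Rat.denseRange_cast a)
  intro x
  have hx := lp.hasSum_single (E := fun _ : J => ℝ) (p := 1) (by simp) x
  refine (rationalPart J).isClosed_topologicalClosure.mem_of_tendsto hx
    (Filter.Eventually.of_forall fun s => ?_)
  refine AddSubgroup.sum_mem _ fun j _ => ?_
  rw [← smul_basisVector]
  exact hr j _

/-- The dense set of finitely supported rational vectors has at most `max #J ℵ₀` elements. -/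
theorem densityCharacter_lt {κ : Cardinal.{u}} (hκ : ℵ₀ < κ) (hJ : #J < κ) :
    densityCharacter (EllOne J) < κ := by
  have h1 : densityCharacter (EllOne J) ≤ #(rationalPart J) :=
    csInf_le' ⟨_, dense_rationalPart, rfl⟩
  have h2 : #(rationalPart J) ≤ #(J →₀ ℚ) := mk_range_le
  have h3 : #(J →₀ ℚ) ≤ max #J ℵ₀ := by
    cases isEmpty_or_nonempty J
    · have : #(J →₀ ℚ) ≤ 1 := Cardinal.le_one_iff_subsingleton.2 inferInstance
      exact this.trans (one_le_aleph0.trans (le_max_right _ _))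
    · simp
  exact (h1.trans (h2.trans h3)).trans_lt (max_lt hJ hκ)

theorem apply_ofFinsupp {X : Type v} [NormedAddCommGroup X] [NormedSpace ℝ X]
    (T : EllOne J →L[ℝ] X) (c : J →₀ ℝ) :
    T (ofFinsupp J c) = Finsupp.linearCombination ℝ (fun j => T (basisVector j)) c := by
  simp [ofFinsupp, Finsupp.linearCombination_apply, Finsupp.sum, map_sum]

/-- The Hahn–Banach theorem in `ℓ₁(J)`. -/
theorem exists_bounded_of_le (N : Submodule ℝ (J →₀ ℝ)) (f : J → ℝ) {C : ℝ} (hC : 0 ≤ C)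
    (hf : ∀ c ∈ N, |Finsupp.linearCombination ℝ f c| ≤ C * ∑ j ∈ c.support, |c j|) :
    ∃ g : J → ℝ, (∀ j, |g j| ≤ C) ∧
      ∀ c ∈ N, Finsupp.linearCombination ℝ f c = Finsupp.linearCombination ℝ g c := by
  obtain ⟨F, t, -, ht, hT⟩ := exists_operator_on_closure (ofFinsupp J) N (Finsupp.linearCombination ℝ f) hC
    (fun c hc => by rw [norm_ofFinsupp]; exact hf c hc)
  obtain ⟨T, hTt, hTn⟩ := exists_extension_norm_eq F t
  refine ⟨fun j => T (basisVector j), fun j => ?_, fun c hc => ?_⟩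
  · have h := T.le_opNorm (basisVector j)
    rw [norm_basisVector, hTn, mul_one] at h
    exact h.trans ht
  · rw [hT T hTt c hc, apply_ofFinsupp]

end EllOne

/-! ### The Kalton–Roberts theorem for finite power sets -/

namespace IsNearlyAdditive

variable {W : Type u} [Fintype W] [DecidableEq W] {f : Finset W → ℝ}

theorem sum_comp_compl (u : Finset W → ℝ) : ∑ A, u Aᶜ = ∑ A, u A :=
  Equiv.sum_comp (compl_involutive (α := Finset W)).toPerm u

theorem sum_filter_mem_comp_compl (u : Finset W → ℝ) (x : W) :
    ∑ A with x ∈ A, u Aᶜ = ∑ A, u A - ∑ A with x ∈ A, u A := by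
  rw [eq_sub_iff_add_eq, Finset.sum_filter, Finset.sum_filter,
    ← sum_comp_compl (fun A => if x ∈ A then u A else 0), ← sum_comp_compl u,
    ← Finset.sum_add_distrib]
  refine Finset.sum_congr rfl fun A _ => ?_
  by_cases h : x ∈ A <;> simp [h]

/-- Moving the positive weight of `A` to `Aᶜ` makes all weights count with the same sign, at a cost
of 1 per unit because `f Aᶜ ≤ 1 - f A`. Every point is then covered with weight `∑ p - s`, so
`le_sum_weighted` applies. -/
theorem sum_mul_le_of_cover_le (hf : IsNearlyAdditive f) (h0 : f Finset.univ = 0) {M : ℝ}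
    (hM : ∀ A, -M ≤ f A) {p q : Finset W → ℝ} (hp : ∀ A, 0 ≤ p A) (hq : ∀ A, 0 ≤ q A) {s : ℝ}
    (hs : ∀ x, ∑ A with x ∈ A, (p A - q A) = s)
    (hle : ∑ A, p A - s ≤ (∑ A, (p A + q A)) / 2) :
    ∑ A, (p A - q A) * f A ≤ (3 / 4 * M + 27) * ∑ A, (p A + q A) := by
  have hsum : ∑ A, (p Aᶜ + q A) = ∑ A, (p A + q A) := by
    rw [Finset.sum_add_distrib, sum_comp_compl, Finset.sum_add_distrib]
  have h1 := hf.le_sum_weighted hM (fun A => p Aᶜ + q A)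
    (fun A => add_nonneg (hp _) (hq _)) (fun x => by
      have hx := hs x
      rw [Finset.sum_sub_distrib] at hx
      rw [hsum, Finset.sum_add_distrib, sum_filter_mem_comp_compl]
      linarith)
  rw [hsum] at h1
  have h2 : ∑ A, (p Aᶜ + q A) * f A = ∑ A, (p A * f Aᶜ + q A * f A) := by
    have := sum_comp_compl fun A => p A * f Aᶜ
    simp only [compl_compl] at this
    rw [Finset.sum_add_distrib, ← this, ← Finset.sum_add_distrib]
    exact Finset.sum_congr rfl fun A _ => by ring
  have h3 : ∑ A, (p A * f Aᶜ + q A * f A) ≤ ∑ A, ((p A + q A) - (p A - q A) * f A) := by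
    refine Finset.sum_le_sum fun A _ => ?_
    have h := hf A Aᶜ disjoint_compl_right
    rw [Finset.union_compl, h0, abs_le] at h
    have hc : f Aᶜ ≤ 1 - f A := by linarith [h.1]
    nlinarith [mul_le_mul_of_nonneg_left hc (hp A), hq A]
  rw [Finset.sum_sub_distrib] at h3
  linarith

/-- For the positive and negative parts `p`, `q` of `c`, the numbers `∑ p - s` and `∑ q + s` add up
to `∑ |c A|`, so one of them is at most half of it; in the second case pass to `-f` and `-c`. -/
theorem sum_mul_le_of_const_cover (hf : IsNearlyAdditive f) (h0 : f Finset.univ = 0) {M : ℝ}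
    (hM : ∀ A, |f A| ≤ M) (c : Finset W → ℝ) {s : ℝ} (hs : ∀ x, ∑ A with x ∈ A, c A = s) :
    ∑ A, c A * f A ≤ (3 / 4 * M + 27) * ∑ A, |c A| := by
  have hp : ∀ A, 0 ≤ max (c A) 0 := fun A => le_max_right _ _
  have hq : ∀ A, 0 ≤ max (-c A) 0 := fun A => le_max_right _ _
  have hd : ∀ A, max (c A) 0 - max (-c A) 0 = c A := fun A => by
    rcases le_total (c A) 0 with h | h <;> simp [h]
  have ha : ∀ A, max (c A) 0 + max (-c A) 0 = |c A| := fun A => by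
    rcases le_total (c A) 0 with h | h <;> simp [h, abs_of_nonneg, abs_of_nonpos]
  have hS : ∑ A, max (c A) 0 + ∑ A, max (-c A) 0 = ∑ A, |c A| := by
    rw [← Finset.sum_add_distrib]
    exact Finset.sum_congr rfl fun A _ => ha A
  rcases le_total (∑ A, max (c A) 0 - s) ((∑ A, |c A|) / 2) with h | h
  · have := hf.sum_mul_le_of_cover_le h0 (fun A => (abs_le.1 (hM A)).1) hp hq (s := s)
      (fun x => by simpa only [hd] using hs x) (by simpa only [ha] using h)
    simpa only [hd, ha] using this
  · have hd' : ∀ A, max (-c A) 0 - max (c A) 0 = -c A := fun A => by linarith [hd A]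
    have ha' : ∀ A, max (-c A) 0 + max (c A) 0 = |c A| := fun A => by linarith [ha A]
    have := hf.neg.sum_mul_le_of_cover_le (by simp [h0])
      (fun A => neg_le_neg (abs_le.1 (hM A)).2) hq hp (s := -s)
      (fun x => by
        simp only [hd', Finset.sum_neg_distrib]
        rw [hs x])
      (by simp only [ha']; linarith)
    simpa only [hd', ha', neg_mul_neg] using this

/-- One step of the approximation: the distance `M` to a measure improves to `3 M / 4 + 27`. -/
theorem exists_additive_step [Nonempty W] (hf : IsNearlyAdditive f) (h0 : f Finset.univ = 0)
    {M : ℝ} (hM : ∀ A, |f A| ≤ M) :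
    ∃ μ : W → ℝ, ∑ x, μ x = 0 ∧ ∀ A, |f A - ∑ x ∈ A, μ x| ≤ 3 / 4 * M + 27 := by
  have hM0 : 0 ≤ M := (abs_nonneg _).trans (hM ∅)
  let cover : W → (Finset W →₀ ℝ) →ₗ[ℝ] ℝ := fun x =>
    Finsupp.linearCombination ℝ fun A => if x ∈ A then (1 : ℝ) else 0
  have hcover : ∀ x c, cover x c = ∑ A with x ∈ A, c A := fun x c => by
    rw [Finset.sum_filter, Finsupp.linearCombination_apply, Finsupp.sum_fintype _ _ (by simp)]
    simp
  -- The coefficient vectors covering all points equally. A Hahn–Banach extension `g` of `f` from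
  -- `N` makes `f - g` vanish on `[A] - ∑ x ∈ A, [{x}]` and on `[univ]`, hence additive with total
  -- mass 0.
  let N : Submodule ℝ (Finset W →₀ ℝ) := ⨅ x, ⨅ y, LinearMap.ker (cover x - cover y)
  have hN : ∀ c, c ∈ N ↔ ∀ x y, cover x c = cover y c := fun c => by
    simp [N, Submodule.mem_iInf, sub_eq_zero]
  have hbound : ∀ c ∈ N, |Finsupp.linearCombination ℝ f c| ≤
      (3 / 4 * M + 27) * ∑ A ∈ c.support, |c A| := by
    intro c hc
    have hs : ∀ x, ∑ A with x ∈ A, c A = cover (Classical.arbitrary W) c := fun x => by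
      rw [← hcover]
      exact (hN c).1 hc _ _
    have h1 := hf.sum_mul_le_of_const_cover h0 hM c hs
    have h2 := hf.sum_mul_le_of_const_cover h0 hM (fun A => -c A)
      (s := -cover (Classical.arbitrary W) c)
      (fun x => by rw [Finset.sum_neg_distrib, hs])
    simp only [neg_mul, Finset.sum_neg_distrib, abs_neg] at h2
    have h3 : ∑ A ∈ c.support, |c A| = ∑ A, |c A| :=
      Finset.sum_subset (Finset.subset_univ _) fun A _ hA => by
        simp [Finsupp.notMem_support_iff.1 hA]
    rw [h3, Finsupp.linearCombination_apply, Finsupp.sum_fintype _ _ (by simp), abs_le]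
    simp only [smul_eq_mul]
    constructor <;> linarith
  obtain ⟨g, hg, hgN⟩ := EllOne.exists_bounded_of_le N f (by positivity) hbound
  refine ⟨fun x => f {x} - g {x}, ?_, fun A => ?_⟩
  all_goals
    have hadd : ∀ A : Finset W, ∑ x ∈ A, (f {x} - g {x}) = f A - g A := by
      intro A
      have h := hgN (Finsupp.single A 1 - ∑ x ∈ A, Finsupp.single {x} 1) ((hN _).2 fun x y => by
        simp [cover, map_sum])
      simp only [map_sub, map_sum, Finsupp.linearCombination_single, one_smul] at h
      rw [Finset.sum_sub_distrib]
      linarith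
    rw [hadd]
  · have h := hgN (Finsupp.single Finset.univ 1) ((hN _).2 fun x y => by simp [cover])
    simp only [Finsupp.linearCombination_single, one_smul] at h
    rw [h, sub_self]
  · rw [sub_sub_cancel]
    exact hg A

/-- The infimum of the achievable distances is at most 108, the fixed point of `M ↦ 3M/4 + 27`;
passing to 109 avoids asking whether it is attained. -/
theorem exists_additive_of_univ_eq_zero [Nonempty W] (hf : IsNearlyAdditive f)
    (h0 : f Finset.univ = 0) : ∃ μ : W → ℝ, ∀ A, |f A - ∑ x ∈ A, μ x| ≤ 109 := by
  let S : Set ℝ := {M | ∃ μ : W → ℝ, ∑ x, μ x = 0 ∧ ∀ A, |f A - ∑ x ∈ A, μ x| ≤ M}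
  have hne : S.Nonempty := ⟨∑ A, |f A|, 0, by simp, fun A => by
    simpa using Finset.single_le_sum (f := fun A => |f A|) (fun A _ => abs_nonneg (f A))
      (Finset.mem_univ A)⟩
  have hbdd : BddBelow S := ⟨0, fun M ⟨μ, _, hμ⟩ => (abs_nonneg _).trans (hμ ∅)⟩
  have hstep : ∀ M ∈ S, 3 / 4 * M + 27 ∈ S := by
    rintro M ⟨μ, hμ0, hμ⟩
    obtain ⟨μ', hμ'0, hμ'⟩ := (hf.sub_sum μ).exists_additive_step (by simp [h0, hμ0]) hμ
    refine ⟨fun x => μ x + μ' x, by simp [Finset.sum_add_distrib, hμ0, hμ'0], fun A => ?_⟩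
    rw [Finset.sum_add_distrib, ← sub_sub]
    exact hμ' A
  have hle : sInf S ≤ 108 := by
    have : (sInf S - 27) * (4 / 3) ≤ sInf S := le_csInf hne fun M hM => by
      linarith [csInf_le hbdd (hstep M hM)]
    linarith
  obtain ⟨M, ⟨μ, -, hμ⟩, hM⟩ := exists_lt_of_csInf_lt hne (hle.trans_lt (by norm_num : _ < (109 : ℝ)))
  exact ⟨μ, fun A => (hμ A).trans hM.le⟩

/-- The Kalton–Roberts theorem for the power set of a finite set. -/
theorem exists_additive (hf : IsNearlyAdditive f) :
    ∃ μ : W → ℝ, ∀ A, |f A - ∑ x ∈ A, μ x| ≤ 109 := by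
  cases isEmpty_or_nonempty W
  · refine ⟨0, fun A => ?_⟩
    rw [Subsingleton.elim A ∅]
    have := hf.abs_empty_le
    simp only [Finset.sum_empty, sub_zero]
    linarith
  · let x₀ := Classical.arbitrary W
    -- A point mass carrying `f univ` normalises the total value to 0.
    obtain ⟨μ, hμ⟩ := (hf.sub_sum (Pi.single x₀ (f Finset.univ))).exists_additive_of_univ_eq_zero
      (by simp)
    refine ⟨fun x => (Pi.single x₀ (f Finset.univ) : W → ℝ) x + μ x, fun A => ?_⟩
    rw [Finset.sum_add_distrib, ← sub_sub]
    exact hμ A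

end IsNearlyAdditive

/-! ### The Kalton–Roberts theorem for set algebras -/

section SetAlgebra

variable {Ω : Type u} {𝓕 : Set (Set Ω)}

/-- The duality form of the Kalton–Roberts theorem: a bound for a `1`-additive real function on
the finite linear relations between indicator functions of members of a set algebra. -/
theorem abs_linearCombination_le_of_indicator_eq_zero (h𝓕 : IsSetAlgebra 𝓕) {ν : Set Ω → ℝ}
    (hν : IsOneAdditiveOn 𝓕 ν) (c : 𝓕 →₀ ℝ)
    (hc : ∀ ω, Finsupp.linearCombination ℝ
      (fun A : 𝓕 => (A : Set Ω).indicator (fun _ => (1 : ℝ)) ω) c = 0) :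
    |Finsupp.linearCombination ℝ (fun A : 𝓕 => ν A) c| ≤ 109 * ∑ A ∈ c.support, |c A| := by
  classical
  -- The fibres of `π` are the atoms of the algebra generated by the support of `c`, so `W` indexes
  -- the nonempty atoms and `E T` is a union of atoms.
  let π : Ω → (c.support → Bool) := fun ω A => decide (ω ∈ (A.1 : Set Ω))
  let W := Set.range π
  let E : Finset W → Set Ω := fun T => {ω | (⟨π ω, ω, rfl⟩ : W) ∈ T}
  have hE : ∀ T, E T ∈ 𝓕 := by
    intro T
    have : E T = ⋃ w ∈ T, ⋂ A ∈ (Finset.univ : Finset c.support),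
        if w.1 A = true then (A.1 : Set Ω) else (A.1 : Set Ω)ᶜ := by
      ext ω
      simp only [Set.mem_iUnion, Set.mem_iInter, exists_prop]
      constructor
      · refine fun h => ⟨_, h, fun A _ => ?_⟩
        by_cases hA : ω ∈ (A.1 : Set Ω) <;> simp [π, hA]
      · rintro ⟨w, hw, h⟩
        have hwω : w = ⟨π ω, ω, rfl⟩ := by
          refine Subtype.ext (funext fun A => ?_)
          have := h A (Finset.mem_univ A)
          by_cases hA : w.1 A = true
          · rw [if_pos hA] at this
            simp [π, hA, this]
          · rw [if_neg hA] at this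
            simpa [π, hA] using this
        rwa [hwω] at hw
    rw [this]
    refine h𝓕.biUnion_mem T fun w _ => h𝓕.biInter_mem _ fun A _ => ?_
    split_ifs
    · exact A.1.2
    · exact h𝓕.compl_mem A.1.2
  have hnear : IsNearlyAdditive fun T => ν (E T) := by
    intro S T hST
    have h1 : E (S ∪ T) = E S ∪ E T := by
      ext ω
      simp [E]
    have h2 : Disjoint (E S) (E T) := Set.disjoint_left.2 fun ω hS hT =>
      Finset.disjoint_left.1 hST hS hT
    have := hν _ (hE S) _ (hE T) h2
    rwa [← h1, Real.norm_eq_abs] at this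
  obtain ⟨μ, hμ⟩ := hnear.exists_additive
  let T : c.support → Finset W := fun A => Finset.univ.filter fun w => w.1 A = true
  have hT : ∀ A, E (T A) = A.1 := fun A => by
    ext ω
    simp [E, T, π]
  -- Measures kill `c`: the coefficient of `μ w` is the indicator relation at any point of the atom
  -- `w`.
  have hzero : ∑ A : c.support, c A.1 * ∑ w ∈ T A, μ w = 0 := by
    simp only [T, Finset.sum_filter, Finset.mul_sum]
    rw [Finset.sum_comm]
    refine Finset.sum_eq_zero fun w _ => ?_
    obtain ⟨ω, hω⟩ := w.2
    have h := hc ω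
    rw [Finsupp.linearCombination_apply, Finsupp.sum, ← Finset.sum_coe_sort] at h
    calc ∑ A : c.support, c A.1 * (if w.1 A = true then μ w else 0)
        = (∑ A : c.support, c A.1 • (A.1 : Set Ω).indicator (fun _ => (1 : ℝ)) ω) * μ w := by
          rw [Finset.sum_mul]
          refine Finset.sum_congr rfl fun A _ => ?_
          rw [← hω]
          by_cases hA : ω ∈ (A.1 : Set Ω) <;> simp [π, hA]
      _ = 0 := by rw [h, zero_mul]
  have hsum : Finsupp.linearCombination ℝ (fun A : 𝓕 => ν A) c =
      ∑ A : c.support, c A.1 * (ν (E (T A)) - ∑ w ∈ T A, μ w) := by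
    simp only [mul_sub]
    rw [Finset.sum_sub_distrib, hzero, sub_zero, Finsupp.linearCombination_apply, Finsupp.sum,
      ← Finset.sum_coe_sort]
    exact Finset.sum_congr rfl fun A _ => by rw [hT, smul_eq_mul]
  rw [hsum, ← Finset.sum_coe_sort c.support fun A => |c A|, Finset.mul_sum]
  refine (Finset.abs_sum_le_sum_abs _ _).trans (Finset.sum_le_sum fun A _ => ?_)
  rw [abs_mul, mul_comm]
  exact mul_le_mul_of_nonneg_right (hμ _) (abs_nonneg _)

theorem isVectorMeasureOn_of_forall {X : Type v} [AddCommGroup X] (h𝓕 : IsSetAlgebra 𝓕)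
    {μ : Set Ω → X} {m : 𝓕 → X} (hμ : ∀ A : 𝓕, μ A = m A)
    (hm : ∀ (A B : 𝓕), Disjoint (A : Set Ω) B →
      m ⟨A ∪ B, h𝓕.union_mem A.2 B.2⟩ - m A - m B = 0) : IsVectorMeasureOn 𝓕 μ := by
  intro A hA B hB hAB
  have h := hm ⟨A, hA⟩ ⟨B, hB⟩ hAB
  rw [← hμ, ← hμ, ← hμ, sub_sub, sub_eq_zero] at h
  exact h

/-- The Kalton–Roberts theorem (with a non-optimal constant). -/
theorem isStableOn_real (h𝓕 : IsSetAlgebra 𝓕) : IsStableOn 𝓕 ℝ 109 := by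
  classical
  intro ν hν
  let N : Submodule ℝ (𝓕 →₀ ℝ) := ⨅ ω : Ω, LinearMap.ker (Finsupp.linearCombination ℝ
    (fun A : 𝓕 => (A : Set Ω).indicator (fun _ => (1 : ℝ)) ω))
  obtain ⟨g, hg, hgN⟩ := EllOne.exists_bounded_of_le N (fun A : 𝓕 => ν A) (C := 109) (by norm_num)
    fun c hc => abs_linearCombination_le_of_indicator_eq_zero h𝓕 hν c fun ω => by
      simpa using (Submodule.mem_iInf _).1 hc ω
  let μ : Set Ω → ℝ := fun A => if h : A ∈ 𝓕 then ν A - g ⟨A, h⟩ else 0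
  have hμ : ∀ A : 𝓕, μ A = ν A - g A := fun A => dif_pos A.2
  refine ⟨μ, isVectorMeasureOn_of_forall h𝓕 hμ fun A B hAB => ?_, fun A hA => ?_⟩
  · have h := hgN (Finsupp.single ⟨A ∪ B, h𝓕.union_mem A.2 B.2⟩ 1 - Finsupp.single A 1 -
      Finsupp.single B 1) ((Submodule.mem_iInf _).2 fun ω => by
        rw [LinearMap.mem_ker]
        simp [Set.indicator_union_of_disjoint hAB])
    simp only [map_sub, Finsupp.linearCombination_single, one_smul] at h
    linarith
  · rw [hμ ⟨A, hA⟩]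
    simpa using hg ⟨A, hA⟩

end SetAlgebra

/-! ### Vector measures from extensions of operators -/

section Family

variable {I : Type u} {Ω : I → Type u} {𝓕 : ∀ i, Set (Set (Ω i))}

/-- The span, in the free vector space over all members of a family of set algebras, of the
elements expressing additivity. -/
noncomputable def additivityRelations (h𝓕 : ∀ i, IsSetAlgebra (𝓕 i)) :
    Submodule ℝ ((Σ i, 𝓕 i) →₀ ℝ) :=
  Submodule.span ℝ {c | ∃ (i : I) (A B : 𝓕 i), Disjoint (A : Set (Ω i)) B ∧
    c = Finsupp.single ⟨i, ⟨A ∪ B, (h𝓕 i).union_mem A.2 B.2⟩⟩ 1 -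
      Finsupp.single ⟨i, A⟩ 1 - Finsupp.single ⟨i, B⟩ 1}

variable {X : Type v} [NormedAddCommGroup X] [NormedSpace ℝ X]

/-- For a norming functional `φ` of the left-hand vector, each `φ ∘ ν i` is `1`-additive and so lies
within `k` of a real measure. These measures vanish on `c`, leaving only the differences. -/
theorem norm_linearCombination_le_of_mem_additivityRelations
    (h𝓕 : ∀ i, IsSetAlgebra (𝓕 i)) {k : ℝ} (hk : ∀ i, IsStableOn (𝓕 i) ℝ k)
    {ν : ∀ i, Set (Ω i) → X} (hν : ∀ i, IsOneAdditiveOn (𝓕 i) (ν i))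
    {c : (Σ i, 𝓕 i) →₀ ℝ} (hc : c ∈ additivityRelations h𝓕) :
    ‖Finsupp.linearCombination ℝ (fun p : Σ i, 𝓕 i => ν p.1 p.2) c‖ ≤
      k * ∑ p ∈ c.support, |c p| := by
  obtain ⟨φ, hφ, hφc⟩ := exists_dual_vector'' ℝ
    (Finsupp.linearCombination ℝ (fun p : Σ i, 𝓕 i => ν p.1 p.2) c)
  have hstab : ∀ i, ∃ m : Set (Ω i) → ℝ, IsVectorMeasureOn (𝓕 i) m ∧
      ∀ A ∈ 𝓕 i, ‖φ (ν i A) - m A‖ ≤ k := fun i => hk i (fun A => φ (ν i A)) fun A hA B hB hAB => by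
    rw [← map_sub, ← map_sub]
    calc _ ≤ ‖φ‖ * ‖ν i (A ∪ B) - ν i A - ν i B‖ := φ.le_opNorm _
      _ ≤ 1 * 1 := by
        gcongr
        exact hν i A hA B hB hAB
      _ = 1 := one_mul 1
  choose m hm hmk using hstab
  have hzero : Finsupp.linearCombination ℝ (fun p : Σ i, 𝓕 i => m p.1 p.2) c = 0 := by
    rw [← LinearMap.mem_ker]
    refine Submodule.span_le.2 ?_ hc
    rintro _ ⟨i, A, B, hAB, rfl⟩
    simp [hm i A A.2 B B.2 hAB]
  have heq : ‖Finsupp.linearCombination ℝ (fun p : Σ i, 𝓕 i => ν p.1 p.2) c‖ =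
      ∑ p ∈ c.support, c p * (φ (ν p.1 p.2) - m p.1 p.2) := by
    have h1 : φ (Finsupp.linearCombination ℝ (fun p : Σ i, 𝓕 i => ν p.1 p.2) c) =
        ∑ p ∈ c.support, c p * φ (ν p.1 p.2) := by
      simp [Finsupp.linearCombination_apply, Finsupp.sum, map_sum]
    simp only [Finsupp.linearCombination_apply, Finsupp.sum, smul_eq_mul] at hzero
    simp only [mul_sub]
    rw [Finset.sum_sub_distrib, hzero, sub_zero, ← h1, hφc]
    rfl
  rw [heq, Finset.mul_sum]
  refine Finset.sum_le_sum fun p _ => ?_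
  calc c p * (φ (ν p.1 p.2) - m p.1 p.2) ≤ |c p| * |φ (ν p.1 p.2) - m p.1 p.2| := by
        rw [← abs_mul]
        exact le_abs_self _
    _ ≤ |c p| * k := by
        gcongr
        exact hmk _ _ p.2.2
    _ = k * |c p| := mul_comm _ _

/-- For a family of `1`-additive functions there is an operator on a closed subspace of `ℓ₁`, each
of whose extensions yields approximating vector measures for the whole family. -/
theorem exists_operator_forall_extension [CompleteSpace X] (h𝓕 : ∀ i, IsSetAlgebra (𝓕 i))
    {k : ℝ} (hk0 : 0 ≤ k) (hk : ∀ i, IsStableOn (𝓕 i) ℝ k)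
    {ν : ∀ i, Set (Ω i) → X} (hν : ∀ i, IsOneAdditiveOn (𝓕 i) (ν i)) :
    ∃ (F : Submodule ℝ (EllOne (Σ i, 𝓕 i))) (t : F →L[ℝ] X),
      IsClosed (F : Set (EllOne (Σ i, 𝓕 i))) ∧ ‖t‖ ≤ k ∧
      ∀ T : EllOne (Σ i, 𝓕 i) →L[ℝ] X, (∀ x : F, T x = t x) →
        ∀ i, ∃ μ : Set (Ω i) → X, IsVectorMeasureOn (𝓕 i) μ ∧
          ∀ A ∈ 𝓕 i, ‖ν i A - μ A‖ ≤ ‖T‖ := by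
  classical
  obtain ⟨F, t, hF, ht, hT⟩ := exists_operator_on_closure (EllOne.ofFinsupp (Σ i, 𝓕 i))
    (additivityRelations h𝓕) (Finsupp.linearCombination ℝ fun p => ν p.1 p.2) hk0
    (fun c hc => by
      rw [EllOne.norm_ofFinsupp]
      exact norm_linearCombination_le_of_mem_additivityRelations h𝓕 hk hν hc)
  refine ⟨F, t, hF, ht, fun T hTt i => ?_⟩
  -- `T` agrees with `ν` on the additivity relations, so `ν A - T e_A` satisfies them exactly.
  let μ : Set (Ω i) → X := fun A =>
    if h : A ∈ 𝓕 i then ν i A - T (EllOne.basisVector ⟨i, A, h⟩) else 0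
  have hμ : ∀ A : 𝓕 i, μ A = ν i A - T (EllOne.basisVector ⟨i, A⟩) := fun A => dif_pos A.2
  refine ⟨μ, isVectorMeasureOn_of_forall (h𝓕 i) hμ fun A B hAB => ?_, fun A hA => ?_⟩
  · have h := hT T hTt _ (Submodule.subset_span ⟨i, A, B, hAB, rfl⟩)
    rw [EllOne.apply_ofFinsupp] at h
    simp only [map_sub, Finsupp.linearCombination_single, one_smul] at h
    rw [← sub_eq_zero] at h
    rw [← h]
    abel
  · rw [hμ ⟨A, hA⟩, sub_sub_cancel]
    have h := T.le_opNorm (EllOne.basisVector ⟨i, ⟨A, hA⟩⟩)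
    rwa [EllOne.norm_basisVector, mul_one] at h

end Family

/-! ### Stability constants -/

section Constants

variable {X : Type u} [NormedAddCommGroup X]

theorem IsStableOn.mono {Ω : Type u} {𝓕 : Set (Set Ω)}
    {c d : ℝ} (h : IsStableOn 𝓕 X c) (hcd : c ≤ d) : IsStableOn 𝓕 X d := fun ν hν => by
  obtain ⟨μ, hμ, hc⟩ := h ν hν
  exact ⟨μ, hμ, fun A hA => (hc A hA).trans hcd⟩

theorem HasCardSVM.mono {κ κ' : Cardinal.{u}} (h : HasCardSVM κ X) (hκ : κ' ≤ κ) :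
    HasCardSVM κ' X := by
  obtain ⟨c, hc, h⟩ := h
  exact ⟨c, hc, fun Ω 𝓕 h𝓕 hcard => h Ω 𝓕 h𝓕 (hcard.trans_le hκ)⟩

/-- A space with the `κ`-`SVM` property for every `κ` has the `SVM` property. -/
theorem hasSVM_of_forall_hasCardSVM (h : ∀ κ : Cardinal.{u}, HasCardSVM κ X) : HasSVM X := by
  by_contra hn
  have : ∀ n : ℕ, ∃ (Ω : Type u) (𝓕 : Set (Set Ω)), IsSetAlgebra 𝓕 ∧ ¬ IsStableOn 𝓕 X n := by
    intro n
    by_contra! hall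
    exact hn ⟨n, n.cast_nonneg, hall⟩
  choose Ω 𝓕 h𝓕 hns using this
  -- A cardinal above the sizes of all the counterexamples, so that one constant covers them all.
  obtain ⟨c, -, hc⟩ := h (Order.succ (⨆ n : ULift.{u} ℕ, #(𝓕 n.down)))
  obtain ⟨n, hn⟩ := exists_nat_ge c
  refine hns n ((hc (Ω n) (𝓕 n) (h𝓕 n) (Order.lt_succ_iff.2 ?_)).mono hn)
  exact le_ciSup (f := fun n : ULift.{u} ℕ => #(𝓕 n.down)) Cardinal.bddAbove_of_small ⟨n⟩

theorem HasCardSVM.svmCharacterGT {κ : Cardinal.{u}} (h : HasCardSVM κ X) :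
    SVMCharacterGT X κ := by
  by_cases hX : HasSVM X
  · exact Or.inl hX
  · right
    have hne : {κ' : Cardinal.{u} | ¬ HasCardSVM κ' X}.Nonempty := by
      by_contra hemp
      rw [Set.not_nonempty_iff_eq_empty, Set.eq_empty_iff_forall_notMem] at hemp
      exact hX (hasSVM_of_forall_hasCardSVM fun κ' => not_not.1 (hemp κ'))
    by_contra hle
    exact csInf_mem hne (h.mono (not_lt.1 hle))

variable [NormedSpace ℝ X] [CompleteSpace X]

theorem IsBoundedCardInjective.isSVMConstant {κ : Cardinal.{u}} (hκ : ℵ₀ < κ) {lam : ℝ}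
    (hX : IsBoundedCardInjective lam κ X) {k : ℝ} (hk0 : 0 ≤ k)
    (hk : ∀ (Ω : Type u) (𝓕 : Set (Set Ω)), IsSetAlgebra 𝓕 → IsStableOn 𝓕 ℝ k) :
    IsSVMConstant κ X (lam * k) := by
  have hlam : 0 ≤ lam := zero_le_one.trans hX.1
  refine ⟨mul_nonneg hlam hk0, fun Ω 𝓕 h𝓕 hcard ν hν => ?_⟩
  obtain ⟨F, t, hF, ht, hT⟩ := exists_operator_forall_extension (I := PUnit.{u + 1})
    (Ω := fun _ => Ω) (𝓕 := fun _ => 𝓕) (fun _ => h𝓕) hk0 (fun _ => hk Ω 𝓕 h𝓕)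
    (ν := fun _ => ν) (fun _ => hν)
  obtain ⟨T, hTt, hTn⟩ := hX.2 (EllOne (Σ _ : PUnit.{u + 1}, 𝓕))
    (EllOne.densityCharacter_lt hκ (by simpa using hcard)) F hF t
  obtain ⟨μ, hμ, h⟩ := hT T hTt PUnit.unit
  exact ⟨μ, hμ, fun A hA => (h A hA).trans (hTn.trans (mul_le_mul_of_nonneg_left ht hlam))⟩

/-- Extensions carry no uniform norm bound, so counterexamples for all `n` are handled by one
operator. Uncountable cofinality keeps the disjoint union of the algebras below `κ`, and any `n ≥
‖T‖` is contradictory. -/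
theorem IsCardInjective.hasCardSVM {κ : Cardinal.{u}} (hκ : ℵ₀ < κ.ord.cof)
    (hX : IsCardInjective κ X) : HasCardSVM κ X := by
  by_contra hn
  have : ∀ n : ℕ, ∃ (Ω : Type u) (𝓕 : Set (Set Ω)) (ν : Set Ω → X), IsSetAlgebra 𝓕 ∧ #𝓕 < κ ∧
      IsOneAdditiveOn 𝓕 ν ∧
      ¬ ∃ μ : Set Ω → X, IsVectorMeasureOn 𝓕 μ ∧ ∀ A ∈ 𝓕, ‖ν A - μ A‖ ≤ n := by
    intro n
    by_contra! hall
    refine hn ⟨n, n.cast_nonneg, fun Ω 𝓕 h𝓕 hcard ν hν => ?_⟩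
    by_contra! hμ
    obtain ⟨μ, h1, h2⟩ := hall Ω 𝓕 ν h𝓕 hcard hν
    obtain ⟨A, hA, h3⟩ := hμ μ h1
    exact (h2 A hA).not_gt h3
  choose Ω 𝓕 ν h𝓕 hcard hν hns using this
  have hκ0 : ℵ₀ < κ := hκ.trans_le (Ordinal.cof_ord_le κ)
  have hJ : #(Σ n : ULift.{u} ℕ, 𝓕 n.down) < κ := by
    rw [mk_sigma]
    refine (sum_le_mk_mul_iSup _).trans_lt (mul_lt_of_lt hκ0.le (by simpa using hκ0) ?_)
    exact iSup_lt_of_lt_cof_ord (by simpa using hκ) fun n => hcard n.down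
  obtain ⟨F, t, hF, -, hT⟩ := exists_operator_forall_extension (I := ULift.{u} ℕ)
    (Ω := fun n => Ω n.down) (𝓕 := fun n => 𝓕 n.down) (fun n => h𝓕 n.down) (k := 109)
    (by norm_num) (fun n => isStableOn_real (h𝓕 n.down)) (ν := fun n => ν n.down)
    (fun n => hν n.down)
  obtain ⟨T, hTt⟩ := hX (EllOne (Σ n : ULift.{u} ℕ, 𝓕 n.down))
    (EllOne.densityCharacter_lt hκ0 hJ) F hF t
  obtain ⟨n, hn⟩ := exists_nat_ge ‖T‖
  obtain ⟨μ, hμ, h⟩ := hT T hTt ⟨n⟩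
  exact hns n ⟨μ, hμ, fun A hA => (h A hA).trans hn⟩

theorem IsBoundedCardInjective.svmInf_le {κ : Cardinal.{u}} (hκ : ℵ₀ < κ) {lam : ℝ}
    (hX : IsBoundedCardInjective lam κ X) : svmInf κ X ≤ lam * kaltonRobertsConstant.{u} := by
  have hlam : 0 < lam := zero_lt_one.trans_le hX.1
  rw [mul_comm, ← div_le_iff₀ hlam]
  -- The constant 109 only shows that the infimum is over a nonempty set; comparing with every
  -- admissible `k` avoids attainment.
  refine le_csInf ⟨109, by norm_num, fun Ω 𝓕 h𝓕 => isStableOn_real h𝓕⟩ fun k hk => ?_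
  rw [div_le_iff₀ hlam, mul_comm]
  exact csInf_le ⟨0, fun c hc => hc.1⟩ (hX.isSVMConstant hκ hk.1 hk.2)

end Constants

theorem theorem5p2 (X : Type u) [NormedAddCommGroup X] [NormedSpace ℝ X] [CompleteSpace X]
    (κ : Cardinal.{u}) :
    (ℵ₀ < κ.ord.cof → IsCardInjective κ X → HasCardSVM κ X ∧ SVMCharacterGT X κ) ∧
    (ℵ₀ < κ → ∀ lam : ℝ, IsBoundedCardInjective lam κ X →
      HasCardSVM κ X ∧ SVMCharacterGT X κ ∧
        svmInf κ X ≤ 24 * lam * kaltonRobertsConstant.{u}) := by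
  refine ⟨fun hκ hX => ?_, fun hκ lam hX => ?_⟩
  · have h := hX.hasCardSVM hκ
    exact ⟨h, h.svmCharacterGT⟩
  · have h : HasCardSVM κ X := ⟨_, hX.isSVMConstant hκ (k := 109) (by norm_num)
      fun Ω 𝓕 h𝓕 => isStableOn_real h𝓕⟩
    refine ⟨h, h.svmCharacterGT, (hX.svmInf_le hκ).trans ?_⟩
    have hK : 0 ≤ kaltonRobertsConstant.{u} := Real.sInf_nonneg fun k hk => hk.1
    have : 0 ≤ lam * kaltonRobertsConstant.{u} := mul_nonneg (zero_le_one.trans hX.1) hK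
    -- The bound already holds without the factor 24.
    linarith
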